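/- **Setting.** Let $0\le k\le n$, and let $X$ be the set of words of length $n$ in the alphabet $\{1,2\}$ in which the letter $1$ occurs exactly $k$ times (equivalently, the $k$-subsets of $\{1,\dots,n\}$). Let $\mathcal F$ be the space of complex functions on $X$, with the inner product for which the delta functions $\delta(x)$, $x\in X$, are orthonormal, and with the action $\sigma f=f\circ\sigma^{-1}$ of $S_n$, which permutes the places of words. For $j\le n$ let $S_j\subseteq S_n$ be the subgroup fixing $j+1,\dots,n$. For a Young diagram $\lambda$ with $j$ boxes and a representation $V$ of $S_m$, $m \ge j$, let $V_{j,\lambda}$ be the isotypic component of $V|_{S_j}$ for the irreducible representation (Specht module) of shape $\lambda$. A standard tableau $T$ with $m$ boxes is identified with the chain $\lambda_1\nearrow\dots\nearrow\lambda_m$ of Young diagrams, each obtained from the previous one by adding one box ($\lambda_j$ is formed by the boxes containing $1,\dots,j$); put $V_T=V_{1,\lambda_1}\cap\dots\cap V_{m,\lambda_m}$. A Gelfand–Tsetlin basis of a multiplicity-free representation $V$ of $S_m$ consists of one unit vector from each nonzero $V_T$. For a place $p$ and a letter $c$, let $\mathcal F^{p,c}$ be the span of the $\delta(x)$ such that $x$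 has the letter $c$ at the place $p$. For $0\le i\le n$ let $X_i$ be the set of words $w$ of length $n-i$ in $\{1,2\}$ in which $1$ occurs at most $k$ times. For $w\in X_i$ let $\mathcal F^w$ be the span of the $\delta(x)$ with $x\in X$ ending in $w$; it is a multiplicity-free representation of $S_i$. Let $B^w$ be a Gelfand–Tsetlin basis of $\mathcal F^w$ and $B_i=\bigsqcup_{w\in X_i}B^w$. The label of $b\in B_i$ is the pair $(T,w)$ with $b\in\mathcal F^w_T$; here $w\in X_i$, and $T$ is a standard tableau of shape $(i-a,a)$ with $0\le a\le\min(r,i-r)$, where $k-r$ is the number of letters $1$ in $w$. Let $1\le i\le n$, $b\in B_{i-1}$ and $b'\in B_i$. * $b$ and $b'$ are *related* if both belong to $$\mathcal F_{1,\lambda_1}\cap\dots\cap\mathcal F_{i-1,\lambda_{i-1}}\cap\mathcal F^{i+1,c_{i+1}}\cap\dots\cap\mathcal F^{n,c_n}$$ for some Young diagrams $\lambda_1,\dots,\lambda_{i-1}$ ($\lambda_j$ with $j$ boxes) and some letters $c_{i+1},\dots,c_n\in\{1,2\}$. * A label $(Q,w)$ determines a triple $(P,Q,w)$, where $P$ is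 the semistandard tableau with entries in $\{1,2\}$ that has the shape of $Q$ and for which the letter $1$ occurs $k$ times in $P$ and $w$ together. The Robinson–Schensted insertion step sends $(P,Q,cw')$, with $c$ the first letter of the word, to $(P',Q',w')$, where $P'$ is obtained by row insertion of $c$ into $P$ and $Q'$ is obtained from $Q$ by putting $i$ into the box that was added to the shape. $b$ and $b'$ are *RS-related* if the label of $b'$ is obtained in this way from the label of $b$. **Theorem.** If $b\in B_{i-1}$ and $b'\in B_i$ are RS-related, then they are related. -/

import Mathlib

noncomputable section

namespace Johnson

/-! ### Isotypic components of a representation -/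

/-- The isotypic component of type `σ` in `ρ`: the sum of all subrepresentations of `ρ` that are
isomorphic to `σ`. -/
def isotypic {G V W : Type*} [Group G] [AddCommMonoid V] [Module ℂ V]
    [AddCommMonoid W] [Module ℂ W]
    (ρ : Representation ℂ G V) (σ : Representation ℂ G W) : Submodule ℂ V :=
  ⨆ U : {U : Subrepresentation ρ // Nonempty (U.toRepresentation.Equiv σ)}, U.1.toSubmodule

/-! ### The irreducible representation of `S_m` attached to a Young diagram (Specht module) -/

/-- `S_m` acting on the space with basis the functions `f : {1,…,m} → ℕ`, by `σ · f = f ∘ σ⁻¹`.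
A tabloid is recorded as the function that sends each number to the index of its row. -/
def tabloidRep (m : ℕ) : Representation ℂ (Equiv.Perm (Fin m)) ((Fin m → ℕ) →₀ ℂ) where
  toFun σ := Finsupp.lmapDomain ℂ ℂ (fun f : Fin m → ℕ => f ∘ ⇑σ⁻¹)
  map_one' := by
    apply Finsupp.lhom_ext
    intro f c
    simp [Finsupp.lmapDomain_apply, Finsupp.mapDomain_single]
  map_mul' σ τ := by
    apply Finsupp.lhom_ext
    intro f c
    simp [Finsupp.lmapDomain_apply, Finsupp.mapDomain_single, Function.comp_assoc]

/-- The polytabloid of a bijective filling `t` of the diagram `μ`: the signed sum, over all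
permutations `π` of the cells that preserve every column, of the tabloid of `π ∘ t`. -/
def polytabloid {m : ℕ} (μ : YoungDiagram) (t : Fin m ≃ μ.cells) : (Fin m → ℕ) →₀ ℂ :=
  ∑ π : Equiv.Perm μ.cells with ∀ c, (π c).1.2 = c.1.2,
    Finsupp.single (fun x => (π (t x)).1.1) ((Equiv.Perm.sign π : ℤ) : ℂ)

/-- The span of all polytabloids of shape `μ`, as a subrepresentation. -/
def spechtSub (m : ℕ) (μ : YoungDiagram) : Subrepresentation (tabloidRep m) where
  toSubmodule := Submodule.span ℂ (Set.range (polytabloid (m := m) μ))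
  apply_mem_toSubmodule σ v hv := by
    have key : Submodule.span ℂ (Set.range (polytabloid (m := m) μ)) ≤
        (Submodule.span ℂ (Set.range (polytabloid (m := m) μ))).comap (tabloidRep m σ) := by
      rw [Submodule.span_le]
      rintro _ ⟨t, rfl⟩
      apply Submodule.subset_span
      refine ⟨σ.symm.trans t, ?_⟩
      simp only [polytabloid, map_sum]
      refine Finset.sum_congr rfl fun π _ => ?_
      simp only [tabloidRep, MonoidHom.coe_mk, OneHom.coe_mk, Finsupp.lmapDomain_apply,
        Finsupp.mapDomain_single]
      rfl
    exact key hv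

/-- The Specht module of `S_m` attached to a Young diagram `μ` with `m` boxes. -/
def specht (m : ℕ) (μ : YoungDiagram) :
    Representation ℂ (Equiv.Perm (Fin m)) (spechtSub m μ).toSubmodule :=
  (spechtSub m μ).toRepresentation

/-- The inclusion `S_j ⊆ S_m`: permutations fixing the last `m - j` elements. -/
def symIncl {j m : ℕ} (h : j ≤ m) : Equiv.Perm (Fin j) →* Equiv.Perm (Fin m) :=
  Equiv.Perm.viaEmbeddingHom (Fin.castLEEmb h)

/-- `V_{j,μ}`: the isotypic component, for the Specht module of shape `μ`, of an
`S_m`-representation `V` regarded as an `S_j`-representation. -/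
def isoComp {m : ℕ} {V : Type*} [AddCommMonoid V] [Module ℂ V]
    (ρ : Representation ℂ (Equiv.Perm (Fin m)) V) {j : ℕ} (h : j ≤ m) (μ : YoungDiagram) :
    Submodule ℂ V :=
  isotypic (ρ.comp (symIncl h)) (specht j μ)

/-! ### Standard tableaux and Gelfand–Tsetlin bases -/

/-- A standard Young tableau with `m` boxes, given as a chain
`∅ = λ₀ ↗ λ₁ ↗ ⋯ ↗ λ_m` of Young diagrams, each obtained from the previous one by adding a box
(the box that contains the corresponding number). -/
structure StdTableau (m : ℕ) where
  chain : Fin (m + 1) → YoungDiagram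
  chain_zero : chain 0 = ⊥
  chain_le : ∀ j : Fin m, chain j.castSucc ≤ chain j.succ
  chain_card : ∀ j : Fin m, (chain j.succ).card = (chain j.castSucc).card + 1

/-- The shape of a standard tableau. -/
def StdTableau.shape {m : ℕ} (T : StdTableau m) : YoungDiagram := T.chain (Fin.last m)

/-- The Gelfand–Tsetlin subspace `V_T = V_{1,λ₁} ∩ ⋯ ∩ V_{m,λ_m}` of an `S_m`-representation. -/
def gtSpace {m : ℕ} {V : Type*} [AddCommMonoid V] [Module ℂ V]
    (ρ : Representation ℂ (Equiv.Perm (Fin m)) V) (T : StdTableau m) : Submodule ℂ V :=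
  ⨅ j : Fin m, isoComp ρ (Nat.succ_le_of_lt j.isLt) (T.chain j.succ)

/-- `B` is a Gelfand–Tsetlin basis of the (multiplicity-free) `S_m`-representation `V`: it is
obtained by choosing one unit vector in each nonzero space `V_T`. -/
def IsGTBasis {m : ℕ} {V : Type*} [NormedAddCommGroup V] [InnerProductSpace ℂ V]
    (ρ : Representation ℂ (Equiv.Perm (Fin m)) V) (B : Set V) : Prop :=
  ∃ v : {T : StdTableau m // gtSpace ρ T ≠ ⊥} → V,
    (∀ T, v T ∈ gtSpace ρ T.1 ∧ ‖v T‖ = 1) ∧ B = Set.range v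

/-! ### The function space on the Johnson graph -/

/-- The alphabet `{1, 2}`. -/
abbrev Letter : Type := {c : ℕ // c ∈ Finset.Icc 1 2}

/-- The number of occurrences of the letter `1`. -/
def ones (w : List Letter) : ℕ := w.countP (fun c : Letter => c.1 = 1)

/-- The set `X` of `k`-sets in `{1,…,n}`, as words of length `n` in which the letter `1`
occurs `k` times. -/
abbrev Word (n k : ℕ) : Type := {x : Fin n → Letter // ones (List.ofFn x) = k}

/-- The action of `S_n` on words: the letter of `σ x` at the place `σ p` is that of `x` at `p`. -/
def permWord {n k : ℕ} (σ : Equiv.Perm (Fin n)) (x : Word n k) : Word n k :=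
  ⟨x.1 ∘ ⇑σ⁻¹, by
    refine Eq.trans ?_ x.2
    unfold ones
    exact (Equiv.Perm.ofFn_comp_perm σ⁻¹ x.1).countP_eq _⟩

theorem permWord_one {n k : ℕ} (x : Word n k) : permWord 1 x = x := rfl

theorem permWord_mul {n k : ℕ} (σ τ : Equiv.Perm (Fin n)) (x : Word n k) :
    permWord (σ * τ) x = permWord σ (permWord τ x) := by
  apply Subtype.ext
  funext p
  simp [permWord]

/-- The space `𝓕` of complex functions on `X`, with the inner product for which the delta
functions are orthonormal. -/
abbrev FunSpace (n k : ℕ) : Type := EuclideanSpace ℂ (Word n k)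

/-- The delta function at a word. -/
def delta {n k : ℕ} (x : Word n k) : FunSpace n k := EuclideanSpace.single x 1

/-- The representation of `S_n` on `𝓕`, `σ f = f ∘ σ⁻¹`. -/
def funRep (n k : ℕ) : Representation ℂ (Equiv.Perm (Fin n)) (FunSpace n k) where
  toFun σ :=
    { toFun := fun f => WithLp.toLp 2 (fun x => f (permWord σ⁻¹ x))
      map_add' := fun f g => by ext x; simp
      map_smul' := fun c f => by ext x; simp }
  map_one' := by
    ext f x
    simp [permWord_one]
  map_mul' σ τ := by
    ext f x
    simp [permWord_mul]

/-- `𝓕^{p,c}`: the span of the delta functions of the words with the letter `c` at the place `p`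
(places are numbered from `0`). -/
def letterSpace (n k : ℕ) (p : Fin n) (c : Letter) : Submodule ℂ (FunSpace n k) :=
  Submodule.span ℂ (delta '' {x : Word n k | x.1 p = c})

/-- `X_i`: words of length `n - i` in which the letter `1` occurs at most `k` times. -/
abbrev SuffixWord (n k i : ℕ) : Type := {w : List Letter // w.length + i = n ∧ ones w ≤ k}

/-- `X^w`: the words in `X` of the form `w' w`. -/
def wordsEndingIn {n k i : ℕ} (w : SuffixWord n k i) : Set (Word n k) :=
  {x | w.1 <:+ List.ofFn x.1}

/-- `𝓕^w`: the span of the delta functions of the words in `X^w`. -/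
def suffixSpace {n k i : ℕ} (w : SuffixWord n k i) : Submodule ℂ (FunSpace n k) :=
  Submodule.span ℂ (delta '' wordsEndingIn w)

theorem SuffixWord.le {n k i : ℕ} (w : SuffixWord n k i) : i ≤ n := by
  have := w.2.1
  omega

theorem symIncl_inv_apply_of_le {j m : ℕ} (h : j ≤ m) (σ : Equiv.Perm (Fin j)) (p : Fin m)
    (hp : j ≤ p.val) : (symIncl h σ)⁻¹ p = p := by
  rw [← map_inv]
  apply Equiv.Perm.viaEmbedding_apply_of_notMem
  rintro ⟨q, rfl⟩
  have := q.isLt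
  simp at hp
  omega

theorem permWord_mem {n k i : ℕ} (w : SuffixWord n k i) (σ : Equiv.Perm (Fin i))
    (x : Word n k) (hx : x ∈ wordsEndingIn w) :
    permWord (symIncl (SuffixWord.le w) σ) x ∈ wordsEndingIn w := by
  have hw := w.2.1
  have hn : n - w.1.length = i := by omega
  simp only [wordsEndingIn, Set.mem_ofPred_eq, List.suffix_iff_eq_drop, List.length_ofFn, hn]
    at hx ⊢
  refine hx.trans (List.ext_getElem (by simp) fun t h1 h2 => ?_)
  simp only [List.getElem_drop, List.getElem_ofFn, permWord, Function.comp_apply]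
  rw [symIncl_inv_apply_of_le]
  simp

theorem funRep_delta {n k : ℕ} (σ : Equiv.Perm (Fin n)) (x : Word n k) :
    funRep n k σ (delta x) = delta (permWord σ x) := by
  ext y
  have h : permWord σ⁻¹ y = x ↔ y = permWord σ x := by
    constructor
    · rintro rfl
      simp [← permWord_mul, permWord_one]
    · rintro rfl
      simp [← permWord_mul, permWord_one]
  simp only [funRep, delta, MonoidHom.coe_mk, OneHom.coe_mk, LinearMap.coe_mk, AddHom.coe_mk]
  simp [h]

/-- `𝓕^w` is stable under `S_i`. -/
def suffixSub {n k i : ℕ} (w : SuffixWord n k i) :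
    Subrepresentation ((funRep n k).comp (symIncl (SuffixWord.le w))) where
  toSubmodule := suffixSpace w
  apply_mem_toSubmodule σ v hv := by
    have key : suffixSpace w ≤
        (suffixSpace w).comap ((funRep n k).comp (symIncl (SuffixWord.le w)) σ) := by
      conv_lhs => rw [suffixSpace]
      rw [Submodule.span_le]
      rintro _ ⟨x, hx, rfl⟩
      apply Submodule.subset_span
      exact ⟨_, permWord_mem w σ x hx, (funRep_delta _ x).symm⟩
    exact key hv

/-- The representation of `S_i` on `𝓕^w`. -/
def suffixRep {n k i : ℕ} (w : SuffixWord n k i) :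
    Representation ℂ (Equiv.Perm (Fin i)) (suffixSpace w) :=
  (suffixSub w).toRepresentation

/-- `B` is an `i`-th intermediate basis `B_i = ⨆_w B^w` of `𝓕`, where `B^w` is a Gelfand–Tsetlin
basis of the `S_i`-representation `𝓕^w` and `w` runs over `X_i`. -/
def IsIntermediateBasis (n k i : ℕ) (B : Set (FunSpace n k)) : Prop :=
  ∃ Bw : (w : SuffixWord n k i) → Set (suffixSpace w),
    (∀ w, IsGTBasis (suffixRep w) (Bw w)) ∧ B = ⋃ w, Subtype.val '' Bw w

/-! ### Labels, and the relation between consecutive bases -/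

/-- The labels of the elements of `B_i`: a word `w ∈ X_i` and a standard tableau of shape
`(i - a, a)` with `0 ≤ a ≤ min (r, i - r)`, where `k - r` is the number of letters `1` in `w`. -/
structure Label (n k i : ℕ) where
  tableau : StdTableau i
  word : SuffixWord n k i
  shape_eq : ∃ r a : ℕ, ones word.1 + r = k ∧ r ≤ i ∧ a ≤ min r (i - r) ∧
    tableau.shape.rowLen 0 = i - a ∧ tableau.shape.rowLen 1 = a ∧ tableau.shape.rowLen 2 = 0

/-- The label of `b` is `(T, w)`: the vector `b` lies in the Gelfand–Tsetlin subspace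
`𝓕^w_T` of `𝓕^w`. -/
def HasLabel {n k i : ℕ} (b : FunSpace n k) (l : Label n k i) : Prop :=
  b ∈ (gtSpace (suffixRep l.word) l.tableau).map (suffixSpace l.word).subtype

/-- Vectors `b ∈ B_i` and `b' ∈ B_{i+1}` are related: both belong to
`𝓕_{1,λ₁} ∩ ⋯ ∩ 𝓕_{i,λ_i} ∩ 𝓕^{i+2,c_{i+2}} ∩ ⋯ ∩ 𝓕^{n,c_n}` for some Young diagrams `λ_j` with
`j` boxes and some letters `c_p`. (Here `j + 1` runs over `1,…,i`, and `p + 1` over `i+2,…,n`.) -/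
def Related {n k i : ℕ} (hi : i + 1 ≤ n) (b b' : FunSpace n k) : Prop :=
  ∃ (d : Fin i → YoungDiagram) (c : Fin n → Letter), (∀ j, (d j).card = j.val + 1) ∧
    ∀ v ∈ ({b, b'} : Set (FunSpace n k)),
      (∀ j : Fin i, v ∈ isoComp (funRep n k) (j := j.val + 1) (by omega) (d j)) ∧
      (∀ p : Fin n, i + 1 ≤ p.val → v ∈ letterSpace n k p (c p))

/-! ### Robinson–Schensted insertion -/

/-- Inserting `x` into a weakly increasing row: `x` replaces the leftmost entry larger than `x`,
which is bumped out (second component), or is appended at the end if there is no such entry. -/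
def rowInsert (x : ℕ) : List ℕ → List ℕ × Option ℕ
  | [] => ([x], none)
  | y :: ys => if x < y then (x :: ys, some y)
      else (y :: (rowInsert x ys).1, (rowInsert x ys).2)

/-- Row insertion of `x` into a tableau given by the list of its rows: an entry bumped out of a
row is inserted into the next row. -/
def rsInsert (x : ℕ) : List (List ℕ) → List (List ℕ)
  | [] => [[x]]
  | R :: Rs => (rowInsert x R).1 ::
      match (rowInsert x R).2 with
      | none => Rs
      | some y => rsInsert y Rs

/-- The list of rows of a semistandard tableau. -/
def rows {μ : YoungDiagram} (P : SemistandardYoungTableau μ) : List (List ℕ) :=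
  (List.range (μ.colLen 0)).map fun r => (List.range (μ.rowLen r)).map fun c => P r c

/-- `P` is the semistandard tableau, filled with `1` and `2`, that completes the pair `(Q, w)` to
a triple `(P, Q, w)`: it has the shape of `Q`, and the letter `1` occurs `k` times in `P` and `w`
together. -/
def Completes {n k i : ℕ} (l : Label n k i) (P : SemistandardYoungTableau l.tableau.shape) :
    Prop :=
  (∀ c ∈ l.tableau.shape.cells, P c.1 c.2 = 1 ∨ P c.1 c.2 = 2) ∧
    (rows P).flatten.count 1 + ones l.word.1 = k

/-- One Robinson–Schensted insertion step `(P, Q, c w') ↦ (P', Q', w')`: `P'` is the result of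
inserting `c` into `P`, and `Q'` is obtained from `Q` by putting the number `i + 1` into the box
that has been added to the shape. -/
def RSStep {n k i : ℕ} (l : Label n k i) (l' : Label n k (i + 1)) : Prop :=
  ∃ (P : SemistandardYoungTableau l.tableau.shape)
    (P' : SemistandardYoungTableau l'.tableau.shape) (c : Letter),
    Completes l P ∧ Completes l' P' ∧ l.word.1 = c :: l'.word.1 ∧
      rows P' = rsInsert c (rows P) ∧
      ∀ j : Fin (i + 1), l'.tableau.chain j.castSucc = l.tableau.chain j

/-- Vectors `b ∈ B_i` and `b' ∈ B_{i+1}` are RS-related: the label of `b'` is obtained from the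
label of `b` by one Robinson–Schensted insertion step. -/
def RSRelated {n k : ℕ} (i : ℕ) (b b' : FunSpace n k) : Prop :=
  ∃ (l : Label n k i) (l' : Label n k (i + 1)), HasLabel b l ∧ HasLabel b' l' ∧ RSStep l l'

end Johnson

end

/-!
An insertion step strips one letter off the front of the word and adds one diagram at the end of the
chain, so the two labels share the letters at the places `i + 2, …, n` and the diagrams
`λ₁, …, λ_i`. This suffices because `𝓕^w_T` lies in `𝓕_{j,λ_j}` and in `𝓕^{p,c_p}`: the latter
since all words in `X^w` have the same letter at the place `p`, the former since the inclusion
`𝓕^w → 𝓕` is an injective `S_j`-map and thus preserves isotypic types.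
-/

namespace Johnson

section Isotypic

variable {G V V' W : Type*} [Group G] [AddCommMonoid V] [Module ℂ V] [AddCommMonoid V']
  [Module ℂ V'] [AddCommMonoid W] [Module ℂ W] {ρ : Representation ℂ G V}
  {ρ' : Representation ℂ G V'} {σ : Representation ℂ G W}

theorem toSubmodule_le_isotypic {U : Subrepresentation ρ} (e : U.toRepresentation.Equiv σ) :
    U.toSubmodule ≤ isotypic ρ σ :=
  le_iSup (fun U : {U : Subrepresentation ρ // Nonempty (U.toRepresentation.Equiv σ)} =>
    U.1.toSubmodule) ⟨U, ⟨e⟩⟩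

theorem range_le_isotypic {f : σ.IntertwiningMap ρ} (hf : Function.Injective f) :
    LinearMap.range f.toLinearMap ≤ isotypic ρ σ :=
  toSubmodule_le_isotypic (U := f.range) <| .symm <|
    .mk (LinearEquiv.ofInjective f.toLinearMap hf) fun g => by
      ext v
      exact f.isIntertwining _ _ g v

theorem map_isotypic_le {f : ρ.IntertwiningMap ρ'} (hf : Function.Injective f) :
    (isotypic ρ σ).map f.toLinearMap ≤ isotypic ρ' σ := by
  rw [isotypic, Submodule.map_iSup]
  refine iSup_le fun ⟨U, ⟨e⟩⟩ => ?_
  let incl : U.toRepresentation.IntertwiningMap ρ := ⟨U.toSubmodule.subtype, fun _ => rfl⟩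
  let g : σ.IntertwiningMap ρ' := (f.comp incl).comp e.symm.toIntertwiningMap
  have hg : Function.Injective g :=
    (hf.comp U.toSubmodule.subtype_injective).comp e.symm.toLinearEquiv.injective
  calc U.toSubmodule.map f.toLinearMap
      ≤ LinearMap.range g.toLinearMap := by
        rintro _ ⟨u, hu, rfl⟩
        exact ⟨e ⟨u, hu⟩, by simp [g, incl]⟩
    _ ≤ isotypic ρ' σ := range_le_isotypic hg

end Isotypic

section SymmetricGroup

theorem viaEmbedding_viaEmbedding {α β γ : Type*} (f : α ↪ β) (g : β ↪ γ) (σ : Equiv.Perm α) :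
    (σ.viaEmbedding f).viaEmbedding g = σ.viaEmbedding (f.trans g) := by
  ext z
  by_cases hz : z ∈ Set.range g
  · obtain ⟨y, rfl⟩ := hz
    rw [Equiv.Perm.viaEmbedding_apply]
    by_cases hy : y ∈ Set.range f
    · obtain ⟨x, rfl⟩ := hy
      rw [Equiv.Perm.viaEmbedding_apply]
      exact (σ.viaEmbedding_apply (f.trans g) x).symm
    · rw [Equiv.Perm.viaEmbedding_apply_of_notMem _ _ _ hy,
        Equiv.Perm.viaEmbedding_apply_of_notMem]
      rintro ⟨x, hx⟩
      exact hy ⟨x, g.injective hx⟩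
  · rw [Equiv.Perm.viaEmbedding_apply_of_notMem _ _ _ hz,
      Equiv.Perm.viaEmbedding_apply_of_notMem]
    rintro ⟨x, rfl⟩
    exact hz ⟨f x, rfl⟩

theorem symIncl_comp_symIncl {j m n : ℕ} (h : j ≤ m) (h' : m ≤ n) :
    (symIncl h').comp (symIncl h) = symIncl (h.trans h') :=
  MonoidHom.ext (viaEmbedding_viaEmbedding (Fin.castLEEmb h) (Fin.castLEEmb h'))

variable {V V' : Type*} [AddCommMonoid V] [Module ℂ V] [AddCommMonoid V'] [Module ℂ V']

theorem isoComp_comp_symIncl {j m n : ℕ} (ρ : Representation ℂ (Equiv.Perm (Fin n)) V)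
    (h : j ≤ m) (h' : m ≤ n) (μ : YoungDiagram) :
    isoComp (ρ.comp (symIncl h')) h μ = isoComp ρ (h.trans h') μ := by
  simp only [isoComp, MonoidHom.comp_assoc, symIncl_comp_symIncl]

theorem map_isoComp_le {j m : ℕ} {ρ : Representation ℂ (Equiv.Perm (Fin m)) V}
    {ρ' : Representation ℂ (Equiv.Perm (Fin m)) V'} {f : ρ.IntertwiningMap ρ'}
    (hf : Function.Injective f) (h : j ≤ m) (μ : YoungDiagram) :
    (isoComp ρ h μ).map f.toLinearMap ≤ isoComp ρ' h μ :=
  map_isotypic_le (ρ := ρ.comp (symIncl h)) (ρ' := ρ'.comp (symIncl h))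
    (f := ⟨f.toLinearMap, fun σ => f.isIntertwining' (symIncl h σ)⟩) hf

end SymmetricGroup

theorem StdTableau.card_chain {m : ℕ} (T : StdTableau m) (j : Fin (m + 1)) :
    (T.chain j).card = j.val := by
  induction j using Fin.induction with
  | zero => simp [T.chain_zero]
  | succ j ih => simp [T.chain_card, ih]

section SuffixSpaces

variable {n k i : ℕ}

theorem mem_wordsEndingIn_iff_eq_drop {w : SuffixWord n k i} {x : Word n k} :
    x ∈ wordsEndingIn w ↔ w.1 = (List.ofFn x.1).drop i := by
  have hi : n - w.1.length = i := Nat.sub_eq_of_eq_add' w.2.1.symm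
  rw [wordsEndingIn, Set.mem_ofPred_eq, List.suffix_iff_eq_drop, List.length_ofFn, hi]

theorem suffixSpace_le_letterSpace (w : SuffixWord n k i) {p : Fin n} (hp : i ≤ p.val)
    (c : Letter) : suffixSpace w ≤ letterSpace n k p (w.1.getD (p.val - i) c) := by
  refine Submodule.span_mono (Set.image_mono fun x hx => ?_)
  rw [mem_wordsEndingIn_iff_eq_drop] at hx
  simp [hx, List.getD_eq_getElem?_getD, Nat.add_sub_of_le hp]

theorem suffixSpace_le_suffixSpace {j : ℕ} {w : SuffixWord n k i} {w' : SuffixWord n k j}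
    (h : w'.1 <:+ w.1) : suffixSpace w ≤ suffixSpace w' :=
  Submodule.span_mono (Set.image_mono fun _ => h.trans)

/-- The Gelfand–Tsetlin subspace `𝓕^w_T` of `𝓕^w`, regarded as a subspace of `𝓕`; a vector with
label `(T, w)` is an element of it. -/
noncomputable def suffixGTSpace (w : SuffixWord n k i) (T : StdTableau i) :
    Submodule ℂ (FunSpace n k) :=
  (gtSpace (suffixRep w) T).map (suffixSpace w).subtype

theorem suffixGTSpace_le_suffixSpace (w : SuffixWord n k i) (T : StdTableau i) :
    suffixGTSpace w T ≤ suffixSpace w :=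
  Submodule.map_subtype_le _ _

theorem suffixGTSpace_le_isoComp (w : SuffixWord n k i) (T : StdTableau i) (j : Fin i) :
    suffixGTSpace w T ≤
      isoComp (funRep n k) ((Nat.succ_le_of_lt j.isLt).trans w.le) (T.chain j.succ) := by
  let incl : (suffixRep w).IntertwiningMap ((funRep n k).comp (symIncl w.le)) :=
    ⟨(suffixSpace w).subtype, fun _ => rfl⟩
  calc suffixGTSpace w T
      ≤ (isoComp (suffixRep w) (Nat.succ_le_of_lt j.isLt) (T.chain j.succ)).map
          incl.toLinearMap := Submodule.map_mono (iInf_le _ j)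
    _ ≤ isoComp ((funRep n k).comp (symIncl w.le)) (Nat.succ_le_of_lt j.isLt) (T.chain j.succ) :=
        map_isoComp_le (suffixSpace w).subtype_injective _ _
    _ = isoComp (funRep n k) ((Nat.succ_le_of_lt j.isLt).trans w.le) (T.chain j.succ) :=
        isoComp_comp_symIncl _ _ _ _

end SuffixSpaces

end Johnson

open Johnson in
theorem mainTheorem5_general {n k i : ℕ} {w : SuffixWord n k i} {w' : SuffixWord n k (i + 1)}
    {T : StdTableau i} {T' : StdTableau (i + 1)} (hw : w'.1 <:+ w.1)
    (hT : ∀ j : Fin (i + 1), T'.chain j.castSucc = T.chain j) {b b' : FunSpace n k}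
    (hb : b ∈ suffixGTSpace w T) (hb' : b' ∈ suffixGTSpace w' T') :
    Related w'.le b b' := by
  have hb_suffix : b ∈ suffixSpace w' :=
    suffixSpace_le_suffixSpace hw (suffixGTSpace_le_suffixSpace w T hb)
  have hb'_suffix : b' ∈ suffixSpace w' := suffixGTSpace_le_suffixSpace w' T' hb'
  refine ⟨fun j => T.chain j.succ, fun p => w'.1.getD (p.val - (i + 1)) ⟨1, by decide⟩,
    fun j => T.card_chain j.succ, ?_⟩
  rintro v (rfl | rfl)
  · exact ⟨fun j => suffixGTSpace_le_isoComp w T j hb,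
      fun p hp => suffixSpace_le_letterSpace w' hp _ hb_suffix⟩
  · refine ⟨fun j => ?_, fun p hp => suffixSpace_le_letterSpace w' hp _ hb'_suffix⟩
    have hmem := suffixGTSpace_le_isoComp w' T' j.castSucc hb'
    rwa [Fin.succ_castSucc, hT] at hmem

theorem mainTheorem5 (n k i : ℕ) (hi : i + 1 ≤ n)
    (B B' : Set (Johnson.FunSpace n k))
    (hB : Johnson.IsIntermediateBasis n k i B)
    (hB' : Johnson.IsIntermediateBasis n k (i + 1) B')
    (b b' : Johnson.FunSpace n k) (hb : b ∈ B) (hb' : b' ∈ B')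
    (h : Johnson.RSRelated i b b') :
    Johnson.Related hi b b' := by
  obtain ⟨l, l', hl, hl', -, -, c, -, -, hw, -, hchain⟩ := h
  exact mainTheorem5_general (hw ▸ List.suffix_cons c l'.word.1) hchain hl hl'
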